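/- A (finite) cube complex is a topological space that is the union of finitely many topological cubes (homeomorphic images of $[0,1]^k$, $k\ge 0$), closed under taking non-empty faces, such that the intersection of any two of the cubes is empty or a face of both; it is $d$-dimensional if the largest dimension of its cubes is $d$, its vertices are its $0$-dimensional cubes, and its facets are its $d$-dimensional cubes. For every dimension $d\ge 2$ there exists a constant $c(d)>0$ such that for every integer $n\ge 2^d$ there exists a simply connected $d$-dimensional cube complex with at most $n$ vertices and at least $c(d)\cdot n^2$ facets. -/

import Mathlib

universe u

/-- A subset of the standard cube `[0,1]^k` is a (non-empty) face if it is a product of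
non-empty faces `{0}`, `{1}`, `[0,1]` of the unit interval. -/
def IsStdCubeFace {k : ℕ} (F : Set (Fin k → unitInterval)) : Prop :=
  ∃ s : Fin k → Set unitInterval,
    (∀ i, s i = {0} ∨ s i = {1} ∨ s i = Set.univ) ∧ F = Set.univ.pi s

/-- A finite cube complex with underlying topological space `X`: `X` is a union of finitely many
topological cubes, closed under passing to non-empty faces, such that any two cubes which meet
intersect in a common face. The family of cubes lists the cubes of all dimensions,
each of them once. -/
structure CubeComplex (X : Type u) [TopologicalSpace X] where
  /-- the index type of the cubes -/
  Cube : Type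
  finite_cube : Finite Cube
  /-- the dimension of a cube -/
  dim : Cube → ℕ
  /-- the parametrization of a cube by the standard cube of its dimension -/
  map : ∀ a : Cube, (Fin (dim a) → unitInterval) → X
  isClosedEmbedding_map : ∀ a, Topology.IsClosedEmbedding (map a)
  /-- different indices belong to different cubes, as subsets of `X` -/
  range_injective : Function.Injective fun a => Set.range (map a)
  /-- the cubes cover `X` -/
  cover : ∀ x : X, ∃ a, x ∈ Set.range (map a)
  /-- every non-empty face of a cube is a cube of the complex -/
  face_mem : ∀ (a : Cube) (F : Set (Fin (dim a) → unitInterval)), IsStdCubeFace F →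
    ∃ b, Set.range (map b) = map a '' F
  /-- two cubes that meet intersect in a face of both -/
  inter_face : ∀ a b, (Set.range (map a) ∩ Set.range (map b)).Nonempty →
    (∃ F, IsStdCubeFace F ∧ Set.range (map a) ∩ Set.range (map b) = map a '' F) ∧
    (∃ F, IsStdCubeFace F ∧ Set.range (map a) ∩ Set.range (map b) = map b '' F)

namespace CubeComplex

variable {X : Type u} [TopologicalSpace X]

/-- The number of `k`-dimensional cubes (`k = 0`: vertices). -/
noncomputable def numCubes (K : CubeComplex X) (k : ℕ) : ℕ :=
  Nat.card {a : K.Cube // K.dim a = k}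

/-- The maximal dimension of a cube of `K` is `d`. -/
def HasDimension (K : CubeComplex X) (d : ℕ) : Prop :=
  (∀ a, K.dim a ≤ d) ∧ ∃ a, K.dim a = d

/-- The number of facets of a `d`-dimensional complex: its cubes of dimension `d`. -/
noncomputable def numFacets (K : CubeComplex X) (d : ℕ) : ℕ := K.numCubes d

/-- The number of vertices. -/
noncomputable def numVertices (K : CubeComplex X) : ℕ := K.numCubes 0

end CubeComplex

/-! For `d = 2`, take a path with `L` edges and `m` disjoint squares. Wind the path round the
boundary of each square and join the two by the mapping cylinder of this winding map. Every path
edge then spans one 2-cube with an edge of every square, which gives at least `m * L` facets on only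
`4 * m + L + 1` vertices. For `d = k + 2`, multiply everything by `[0,1]^k`. With `m` and `L` both
linear in `n / 2^k`, the number of facets is quadratic in `n`.

Long windings do no harm: two path edges above the same edge of a square share only their top, two
copies share only the path, and so any two cubes meet in a face or not at all (`isCoordCut_sheet`).
To make this checkable, each facet is realized as the graph of a map to `ℝ × ℝ` over a facet of
`[0,1]^(k+3)`; `graphComplex` turns such a family into a cube complex.

Filling in the squares makes each copy contractible, and the copies are glued along the contractible
path times `[0,1]^k`. Explicit homotopies on a parameter space (`contractibleSpace_sheets`) contract
the whole space. -/

/-! ### Faces of the standard cube. -/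

/-- The endpoint of the unit interval with the given label. -/
def endpt (b : Bool) : unitInterval := if b then 1 else 0

theorem endpt_injective : Function.Injective endpt := by
  intro a b h
  cases a <;> cases b <;> simp [endpt] at h ⊢

/-- The face of the standard cube on which the coordinates labelled `some b` equal `endpt b`. -/
def cubeFace {N : ℕ} (e : Fin N → Option Bool) : Set (Fin N → unitInterval) :=
  {t | ∀ i b, e i = some b → t i = endpt b}

theorem isStdCubeFace_iff {N : ℕ} (F : Set (Fin N → unitInterval)) :
    IsStdCubeFace F ↔ ∃ e, F = cubeFace e := by
  constructor
  · rintro ⟨s, hs, rfl⟩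
    have : ∀ i, ∃ o : Option Bool, s i = {y | ∀ b, o = some b → y = endpt b} := by
      intro i
      rcases hs i with h | h | h
      · exact ⟨some false, by rw [h]; ext y; simp [endpt]⟩
      · exact ⟨some true, by rw [h]; ext y; simp [endpt]⟩
      · exact ⟨none, by rw [h]; ext y; simp⟩
    choose e he using this
    refine ⟨e, ?_⟩
    ext t
    simp [cubeFace, he]
  · rintro ⟨e, rfl⟩
    refine ⟨fun i => {y | ∀ b, e i = some b → y = endpt b}, fun i => ?_, ?_⟩
    · rcases h : e i with _ | _ | _
      · right; right; ext y; simp [h]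
      · left; ext y; simp [h, endpt]
      · right; left; ext y; simp [h, endpt]
    · ext t
      simp [cubeFace]

/-- The midpoint of a face. -/
noncomputable def faceMid {N : ℕ} (e : Fin N → Option Bool) (i : Fin N) : unitInterval :=
  match e i with
  | some b => endpt b
  | none => ⟨1 / 2, by norm_num, by norm_num⟩

theorem faceMid_mem {N : ℕ} (e : Fin N → Option Bool) : faceMid e ∈ cubeFace e := by
  intro i b h
  simp [faceMid, h]

theorem faceMid_eq_endpt {N : ℕ} {e : Fin N → Option Bool} {i : Fin N} {b : Bool}
    (h : faceMid e i = endpt b) : e i = some b := by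
  unfold faceMid at h
  rcases he : e i with _ | c
  · rw [he] at h
    have := congrArg Subtype.val h
    cases b <;> norm_num [endpt] at this
  · rw [he] at h
    rw [endpt_injective h]

/-- The midpoint is a generic point of its face: its free coordinates are 1/2, so it satisfies only
the constraints that the face imposes. -/
theorem cubeFace_subset_iff {N : ℕ} {e f : Fin N → Option Bool} :
    cubeFace f ⊆ cubeFace e ↔ ∀ i b, e i = some b → f i = some b :=
  ⟨fun h i b hb => faceMid_eq_endpt (h (faceMid_mem f) i b hb),
    fun h _ ht i b hb => ht i b (h i b hb)⟩

theorem cubeFace_injective {N : ℕ} : Function.Injective (cubeFace (N := N)) := by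
  intro e f h
  have h₁ := cubeFace_subset_iff.1 h.le
  have h₂ := cubeFace_subset_iff.1 h.ge
  ext i b
  exact ⟨h₂ i b, h₁ i b⟩

/-- The free coordinates of a face. -/
def freeCoords {N : ℕ} (e : Fin N → Option Bool) : Finset (Fin N) :=
  Finset.univ.filter fun i => e i = none

/-- The dimension of a face. -/
def faceDim {N : ℕ} (e : Fin N → Option Bool) : ℕ := (freeCoords e).card

/-- The free coordinates of a face, numbered. -/
noncomputable def freeEquiv {N : ℕ} (e : Fin N → Option Bool) :
    freeCoords e ≃ Fin (faceDim e) := (freeCoords e).equivFin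

theorem faceDim_le_of_subset {N : ℕ} {e f : Fin N → Option Bool}
    (h : cubeFace f ⊆ cubeFace e) : faceDim f ≤ faceDim e := by
  refine Finset.card_le_card fun i hi => ?_
  simp only [freeCoords, Finset.mem_filter, Finset.mem_univ, true_and] at hi ⊢
  by_contra hne
  obtain ⟨b, hb⟩ := Option.ne_none_iff_exists'.1 hne
  simp [cubeFace_subset_iff.1 h i b hb] at hi

/-- The parametrization of a face by the standard cube of its dimension. -/
noncomputable def faceParam {N : ℕ} (e : Fin N → Option Bool)
    (u : Fin (faceDim e) → unitInterval) (i : Fin N) : unitInterval :=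
  -- Outside `freeCoords e` the label is some `b`, so the default `false` is never used.
  if h : i ∈ freeCoords e then u (freeEquiv e ⟨i, h⟩) else endpt ((e i).getD false)

theorem faceParam_freeEquiv_symm {N : ℕ} (e : Fin N → Option Bool)
    (u : Fin (faceDim e) → unitInterval) (a : Fin (faceDim e)) :
    faceParam e u ((freeEquiv e).symm a) = u a := by
  simp [faceParam]

theorem faceParam_of_some {N : ℕ} {e : Fin N → Option Bool}
    (u : Fin (faceDim e) → unitInterval) {i : Fin N} {b : Bool} (h : e i = some b) :
    faceParam e u i = endpt b := by
  simp [faceParam, freeCoords, h]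

theorem faceParam_mem {N : ℕ} (e : Fin N → Option Bool) (u : Fin (faceDim e) → unitInterval) :
    faceParam e u ∈ cubeFace e := fun _ _ h => faceParam_of_some u h

theorem continuous_faceParam {N : ℕ} (e : Fin N → Option Bool) : Continuous (faceParam e) := by
  refine continuous_pi fun i => ?_
  by_cases h : i ∈ freeCoords e
  · simp only [faceParam, h, dite_true]
    fun_prop
  · simp only [faceParam, h, dite_false]
    fun_prop

theorem faceParam_injective {N : ℕ} (e : Fin N → Option Bool) :
    Function.Injective (faceParam e) := by
  intro u v h
  ext a
  rw [← faceParam_freeEquiv_symm e u, h, faceParam_freeEquiv_symm]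

theorem exists_faceParam_eq {N : ℕ} {e : Fin N → Option Bool} {t : Fin N → unitInterval}
    (h : t ∈ cubeFace e) : faceParam e (fun a => t ((freeEquiv e).symm a)) = t := by
  ext i
  rcases he : e i with _ | b
  · have hi : i ∈ freeCoords e := by simp [freeCoords, he]
    simp [faceParam, hi]
  · rw [faceParam_of_some _ he, h i b he]

/-- Together with `exists_faceParam_image`, this translates between faces in a face's own
coordinates and the faces of the ambient cube contained in it. -/
theorem faceParam_image {N : ℕ} (e : Fin N → Option Bool) (f : Fin (faceDim e) → Option Bool) :
    ∃ e', cubeFace e' ⊆ cubeFace e ∧ faceParam e '' cubeFace f = cubeFace e' := by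
  have hmem : ∀ i, i ∈ freeCoords e ↔ e i = none := by simp [freeCoords]
  have hsub : cubeFace (fun i => if h : i ∈ freeCoords e then f (freeEquiv e ⟨i, h⟩) else e i) ⊆
      cubeFace e := by
    rw [cubeFace_subset_iff]
    intro i b h
    simp [hmem, h]
  refine ⟨_, hsub, ?_⟩
  ext t
  constructor
  · rintro ⟨u, hu, rfl⟩ i b h
    by_cases hi : i ∈ freeCoords e
    · simp only [hi, dite_true] at h
      simpa [faceParam, hi] using hu _ b h
    · simp only [hi, dite_false] at h
      exact faceParam_of_some u h
  · intro ht
    refine ⟨_, fun a b hb => ?_, exists_faceParam_eq (hsub ht)⟩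
    exact ht _ b (by simpa using hb)

theorem exists_faceParam_image {N : ℕ} {e e' : Fin N → Option Bool}
    (h : cubeFace e' ⊆ cubeFace e) : ∃ f, faceParam e '' cubeFace f = cubeFace e' := by
  refine ⟨fun a => e' ((freeEquiv e).symm a), ?_⟩
  rw [cubeFace_subset_iff] at h
  ext t
  constructor
  · rintro ⟨u, hu, rfl⟩ i b hb
    rcases he : e i with _ | c
    · have hi : i ∈ freeCoords e := by simp [freeCoords, he]
      have := hu (freeEquiv e ⟨i, hi⟩) b (by simpa using hb)
      simpa [faceParam, hi] using this
    · rw [faceParam_of_some u he]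
      have := h i c he
      rw [hb] at this
      rw [Option.some_injective _ this]
  · intro ht
    exact ⟨_, fun a b hb => ht _ b hb, exists_faceParam_eq (cubeFace_subset_iff.2 h ht)⟩

/-! ### Sets cut out by endpoint constraints. -/

/-- A subset of the standard cube cut out by fixing coordinates to endpoints: a face or empty. -/
def IsCoordCut {N : ℕ} (S : Set (Fin N → unitInterval)) : Prop :=
  ∃ C : Set (Fin N × Bool), S = {t | ∀ c ∈ C, t c.1 = endpt c.2}

theorem IsCoordCut.inter {N : ℕ} {S T : Set (Fin N → unitInterval)} (hS : IsCoordCut S)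
    (hT : IsCoordCut T) : IsCoordCut (S ∩ T) := by
  obtain ⟨C, rfl⟩ := hS
  obtain ⟨D, rfl⟩ := hT
  refine ⟨C ∪ D, ?_⟩
  ext t
  simp only [Set.mem_inter_iff, Set.mem_ofPred_eq, Set.mem_union]
  exact ⟨fun h c hc => hc.elim (h.1 c) (h.2 c), fun h => ⟨fun c hc => h c (.inl hc),
    fun c hc => h c (.inr hc)⟩⟩

theorem isCoordCut_cubeFace {N : ℕ} (e : Fin N → Option Bool) : IsCoordCut (cubeFace e) :=
  ⟨{c | e c.1 = some c.2}, by ext t; simp [cubeFace]⟩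

theorem isCoordCut_coord {N : ℕ} (i : Fin N) (b : Bool) :
    IsCoordCut {t : Fin N → unitInterval | t i = endpt b} :=
  ⟨{(i, b)}, by ext t; simp⟩

theorem isCoordCut_empty {N : ℕ} (i : Fin N) :
    IsCoordCut (∅ : Set (Fin N → unitInterval)) := by
  refine ⟨{(i, true), (i, false)}, ?_⟩
  ext t
  simp only [Set.mem_empty_iff_false, Set.mem_ofPred_eq, false_iff]
  intro h
  have := (h (i, true) (by simp)).symm.trans (h (i, false) (by simp))
  exact absurd (endpt_injective this) (by simp)

/-- A point of the set rules out contradictory constraints on one coordinate, so the constraints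
amount to a labelling. -/
theorem IsCoordCut.exists_cubeFace {N : ℕ} {S : Set (Fin N → unitInterval)} (hS : IsCoordCut S)
    (hne : S.Nonempty) : ∃ e, S = cubeFace e := by
  classical
  obtain ⟨C, rfl⟩ := hS
  obtain ⟨t₀, h₀⟩ := hne
  refine ⟨fun i => if (i, true) ∈ C then some true else if (i, false) ∈ C then some false
    else none, ?_⟩
  ext t
  constructor
  · intro ht i b hb
    dsimp only at hb
    split_ifs at hb with h₁ h₂ <;> simp only [Option.some.injEq] at hb <;> subst hb
    · exact ht _ h₁
    · exact ht _ h₂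
  · rintro ht ⟨i, b⟩ hc
    refine ht i b ?_
    rcases b with _ | _
    · have : (i, true) ∉ C := fun h =>
        absurd (endpt_injective ((h₀ (i, true) h).symm.trans (h₀ (i, false) hc))) (by simp)
      simp [this, hc]
    · simp [hc]

/-! ### Cube complexes formed by graphs over faces of a cube. -/

/-- The union of the graphs of the functions `h j` over the faces `g j` of a cube. -/
def graphUnion {N : ℕ} {J Y : Type} (g : J → Fin N → Option Bool)
    (h : J → (Fin N → unitInterval) → Y) : Set ((Fin N → unitInterval) × Y) :=
  {p | ∃ j, p.1 ∈ cubeFace (g j) ∧ p.2 = h j p.1}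

/-- The part of the graph of `h j` that lies over the face `e`. -/
def graphOver {N : ℕ} {J Y : Type} (g : J → Fin N → Option Bool)
    (h : J → (Fin N → unitInterval) → Y) (j : J) (e : Fin N → Option Bool) :
    Set (graphUnion g h) :=
  {p | p.1.1 ∈ cubeFace e ∧ p.1.2 = h j p.1.1}

/-- The cubes of a union of graphs. -/
abbrev GraphCube {N : ℕ} {J Y : Type} (g : J → Fin N → Option Bool)
    (h : J → (Fin N → unitInterval) → Y) : Type :=
  {c : (Fin N → Option Bool) × Set (graphUnion g h) //
    ∃ j, cubeFace c.1 ⊆ cubeFace (g j) ∧ c.2 = graphOver g h j c.1}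

/-- The parametrization of a cube of a union of graphs. -/
noncomputable def graphCubeMap {N : ℕ} {J Y : Type} {g : J → Fin N → Option Bool}
    {h : J → (Fin N → unitInterval) → Y} (a : GraphCube g h)
    (u : Fin (faceDim a.1.1) → unitInterval) : graphUnion g h :=
  ⟨(faceParam a.1.1 u, h a.2.choose (faceParam a.1.1 u)), a.2.choose,
    a.2.choose_spec.1 (faceParam_mem _ u), rfl⟩

theorem graphCubeMap_image {N : ℕ} {J Y : Type} {g : J → Fin N → Option Bool}
    {h : J → (Fin N → unitInterval) → Y} (a : GraphCube g h) (f : Fin (faceDim a.1.1) → Option Bool)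
    {e : Fin N → Option Bool} (he : faceParam a.1.1 '' cubeFace f = cubeFace e) :
    graphCubeMap a '' cubeFace f = graphOver g h a.2.choose e := by
  ext ⟨⟨t, y⟩, hp⟩
  simp only [graphOver, ← he, graphCubeMap, Set.mem_image, Set.mem_ofPred_eq, Subtype.mk.injEq,
    Prod.mk.injEq]
  constructor
  · rintro ⟨u, hu, rfl, rfl⟩
    exact ⟨⟨u, hu, rfl⟩, rfl⟩
  · rintro ⟨⟨u, hu, rfl⟩, rfl⟩
    exact ⟨u, hu, rfl, rfl⟩

theorem range_graphCubeMap {N : ℕ} {J Y : Type} {g : J → Fin N → Option Bool}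
    {h : J → (Fin N → unitInterval) → Y} (a : GraphCube g h) :
    Set.range (graphCubeMap a) = a.1.2 := by
  have huniv : cubeFace (fun _ : Fin (faceDim a.1.1) => none) = Set.univ := by
    ext t; simp [cubeFace]
  have := graphCubeMap_image a (fun _ => none) (e := a.1.1) (by
    rw [huniv]
    ext t
    exact ⟨by rintro ⟨u, -, rfl⟩; exact faceParam_mem _ u,
      fun ht => ⟨_, trivial, exists_faceParam_eq ht⟩⟩)
  rw [huniv, Set.image_univ] at this
  rw [this, ← a.2.choose_spec.2]

theorem fst_image_graphOver {N : ℕ} {J Y : Type} {g : J → Fin N → Option Bool}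
    {h : J → (Fin N → unitInterval) → Y} {j : J} {e : Fin N → Option Bool}
    (he : cubeFace e ⊆ cubeFace (g j)) :
    (fun p : graphUnion g h => p.1.1) '' graphOver g h j e = cubeFace e := by
  ext t
  constructor
  · rintro ⟨p, hp, rfl⟩
    exact hp.1
  · intro ht
    exact ⟨⟨(t, h j t), j, he ht, rfl⟩, ⟨ht, rfl⟩, rfl⟩

/-- Projecting the point set to the cube recovers the face. Cubes are indexed by point sets rather
than by sheets because one cube may lie in several sheets. -/
theorem graphCube_ext {N : ℕ} {J Y : Type} {g : J → Fin N → Option Bool}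
    {h : J → (Fin N → unitInterval) → Y} {a b : GraphCube g h} (hab : a.1.2 = b.1.2) : a = b := by
  obtain ⟨⟨e, S⟩, i, hi, hS⟩ := a
  obtain ⟨⟨f, T⟩, j, hj, hT⟩ := b
  dsimp only at *
  subst hab
  have : e = f := by
    apply cubeFace_injective
    rw [← fst_image_graphOver (h := h) hi, ← fst_image_graphOver (h := h) hj, ← hS, ← hT]
  subst this
  rfl

/-- The intersection is the part of one graph above the set where both faces are present and the two
functions agree. This set is a nonempty coordinate cut, hence a face. -/
theorem graphCube_inter_face {N : ℕ} {J Y : Type} {g : J → Fin N → Option Bool}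
    {h : J → (Fin N → unitInterval) → Y}
    (hE : ∀ i j, IsCoordCut {t | t ∈ cubeFace (g i) ∧ t ∈ cubeFace (g j) ∧ h i t = h j t})
    (a b : GraphCube g h) (hne : (a.1.2 ∩ b.1.2).Nonempty) :
    ∃ F, IsStdCubeFace F ∧ a.1.2 ∩ b.1.2 = graphCubeMap a '' F := by
  have ha := a.2.choose_spec
  have hb := b.2.choose_spec
  have hcut := ((hE a.2.choose b.2.choose).inter
    ((isCoordCut_cubeFace a.1.1).inter (isCoordCut_cubeFace b.1.1)))
  obtain ⟨p, hp⟩ := hne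
  rw [ha.2, hb.2] at hp
  obtain ⟨e, he⟩ := hcut.exists_cubeFace
    ⟨p.1.1, ⟨ha.1 hp.1.1, hb.1 hp.2.1, hp.1.2.symm.trans hp.2.2⟩, hp.1.1, hp.2.1⟩
  have hsub : cubeFace e ⊆ cubeFace a.1.1 := by
    rw [← he]; exact fun t ht => ht.2.1
  obtain ⟨f, hf⟩ := exists_faceParam_image hsub
  refine ⟨cubeFace f, (isStdCubeFace_iff _).2 ⟨f, rfl⟩, ?_⟩
  rw [graphCubeMap_image a f hf]
  conv_lhs => rw [ha.2, hb.2]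
  ext p
  simp only [graphOver, ← he, Set.mem_inter_iff, Set.mem_ofPred_eq]
  constructor
  · rintro ⟨⟨h₁, h₂⟩, h₃, h₄⟩
    exact ⟨⟨⟨ha.1 h₁, hb.1 h₃, h₂.symm.trans h₄⟩, h₁, h₃⟩, h₂⟩
  · rintro ⟨⟨⟨_, _, h₁⟩, h₂, h₃⟩, h₄⟩
    exact ⟨⟨h₂, h₄⟩, h₃, h₄.trans h₁⟩

/-- A union of graphs over faces of a cube is a cube complex, if any two of the graphs agree on
a face or nowhere. -/
noncomputable def graphComplex {N : ℕ} {J Y : Type} [Finite J] [TopologicalSpace Y] [T2Space Y]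
    (g : J → Fin N → Option Bool) (h : J → (Fin N → unitInterval) → Y)
    (hcont : ∀ j, Continuous (h j))
    (hE : ∀ i j, IsCoordCut {t | t ∈ cubeFace (g i) ∧ t ∈ cubeFace (g j) ∧ h i t = h j t}) :
    CubeComplex (graphUnion g h) where
  Cube := GraphCube g h
  finite_cube := by
    refine Finite.of_surjective
      (fun c : {c : J × (Fin N → Option Bool) // cubeFace c.2 ⊆ cubeFace (g c.1)} =>
        (⟨(c.1.2, graphOver g h c.1.1 c.1.2), c.1.1, c.2, rfl⟩ : GraphCube g h)) ?_
    rintro ⟨⟨e, S⟩, j, hj, hS⟩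
    exact ⟨⟨(j, e), hj⟩, Subtype.ext (Prod.ext rfl hS.symm)⟩
  dim a := faceDim a.1.1
  map a := graphCubeMap a
  isClosedEmbedding_map a := by
    refine Continuous.isClosedEmbedding ?_ ?_
    · have := continuous_faceParam a.1.1
      have := hcont a.2.choose
      unfold graphCubeMap
      fun_prop
    · intro u v huv
      exact faceParam_injective _ (congrArg (fun p => p.1.1) huv)
  range_injective := by
    intro a b hab
    simp only [range_graphCubeMap] at hab
    exact graphCube_ext hab
  cover := by
    intro p
    obtain ⟨j, hj, hp⟩ := p.2
    refine ⟨⟨(g j, graphOver g h j (g j)), j, subset_rfl, rfl⟩, ?_⟩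
    rw [range_graphCubeMap]
    exact ⟨hj, hp⟩
  face_mem := by
    intro a F hF
    obtain ⟨f, rfl⟩ := (isStdCubeFace_iff F).1 hF
    obtain ⟨e, hsub, he⟩ := faceParam_image a.1.1 f
    refine ⟨⟨(e, graphOver g h a.2.choose e), a.2.choose, hsub.trans a.2.choose_spec.1, rfl⟩, ?_⟩
    rw [range_graphCubeMap, graphCubeMap_image a f he]
  inter_face := by
    intro a b hne
    simp only [range_graphCubeMap] at hne ⊢
    refine ⟨graphCube_inter_face hE a b hne, ?_⟩
    rw [Set.inter_comm] at hne ⊢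
    exact graphCube_inter_face hE b a hne

theorem graphComplex_hasDimension {N : ℕ} {J Y : Type} [Finite J] [Nonempty J]
    [TopologicalSpace Y] [T2Space Y]
    (g : J → Fin N → Option Bool) (h : J → (Fin N → unitInterval) → Y)
    (hcont : ∀ j, Continuous (h j))
    (hE : ∀ i j, IsCoordCut {t | t ∈ cubeFace (g i) ∧ t ∈ cubeFace (g j) ∧ h i t = h j t})
    {d : ℕ} (hd : ∀ j, faceDim (g j) = d) : (graphComplex g h hcont hE).HasDimension d := by
  constructor
  · rintro ⟨⟨e, S⟩, j, hj, hS⟩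
    exact (faceDim_le_of_subset hj).trans (hd j).le
  · obtain ⟨j⟩ := ‹Nonempty J›
    exact ⟨⟨(g j, graphOver g h j (g j)), j, subset_rfl, rfl⟩, hd j⟩

/-- A 0-dimensional cube is one point above a corner of the ambient cube. If `ν` lists all such
points, possibly with repetitions, the vertices inject into `V`. -/
theorem graphComplex_numVertices_le {N : ℕ} {J Y V : Type} [Finite J] [Finite V]
    [TopologicalSpace Y] [T2Space Y]
    (g : J → Fin N → Option Bool) (h : J → (Fin N → unitInterval) → Y)
    (hcont : ∀ j, Continuous (h j))
    (hE : ∀ i j, IsCoordCut {t | t ∈ cubeFace (g i) ∧ t ∈ cubeFace (g j) ∧ h i t = h j t})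
    (ν : V → (Fin N → Bool) × Y)
    (hν : ∀ j (b : Fin N → Bool), (fun i => endpt (b i)) ∈ cubeFace (g j) →
      ∃ v, ν v = (b, h j fun i => endpt (b i))) :
    (graphComplex g h hcont hE).numVertices ≤ Nat.card V := by
  have key : ∀ a : {a : GraphCube g h // faceDim a.1.1 = 0}, ∃ v,
      a.1.1.1 = (fun i => some ((ν v).1 i)) ∧
      a.1.1.2 = {p | p.1 = (fun i => endpt ((ν v).1 i), (ν v).2)} := by
    rintro ⟨⟨⟨e, S⟩, j, hj, hS⟩, h0⟩
    have he : ∀ i, ∃ b, e i = some b := by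
      intro i
      refine Option.ne_none_iff_exists'.1 fun hi => ?_
      have : i ∈ freeCoords e := by simp [freeCoords, hi]
      rw [Finset.card_eq_zero.1 h0] at this
      simp at this
    choose b hb using he
    have hface : cubeFace e = {fun i => endpt (b i)} := by
      ext t
      simp only [cubeFace, hb, Set.mem_ofPred_eq, Set.mem_singleton_iff, Option.some.injEq,
        forall_eq', funext_iff]
    obtain ⟨v, hv⟩ := hν j b (hj (by rw [hface]; rfl))
    refine ⟨v, ?_, ?_⟩
    · ext1 i
      simp [hv, hb]
    · dsimp only at hS ⊢
      rw [hS]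
      ext p
      simp only [graphOver, hface, hv, Set.mem_ofPred_eq, Set.mem_singleton_iff, Prod.ext_iff]
      exact ⟨fun hp => ⟨hp.1, hp.1 ▸ hp.2⟩, fun hp => ⟨hp.1, hp.1.symm ▸ hp.2⟩⟩
  choose v hv using key
  refine Nat.card_le_card_of_injective v fun a b hab => ?_
  refine Subtype.ext (graphCube_ext ?_)
  rw [(hv a).2, (hv b).2, hab]

/-- `hφ` says that none of the chosen graphs is contained in another, so they are distinct facets.
-/
theorem graphComplex_le_numFacets {N : ℕ} {J Y I : Type} [Finite J]
    [TopologicalSpace Y] [T2Space Y]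
    (g : J → Fin N → Option Bool) (h : J → (Fin N → unitInterval) → Y)
    (hcont : ∀ j, Continuous (h j))
    (hE : ∀ i j, IsCoordCut {t | t ∈ cubeFace (g i) ∧ t ∈ cubeFace (g j) ∧ h i t = h j t})
    {d : ℕ} (φ : I → J) (hd : ∀ x, faceDim (g (φ x)) = d)
    (hφ : ∀ x y, (∀ t ∈ cubeFace (g (φ x)), t ∈ cubeFace (g (φ y)) ∧ h (φ x) t = h (φ y) t) →
      x = y) :
    Nat.card I ≤ (graphComplex g h hcont hE).numFacets d := by
  have : Finite (graphComplex g h hcont hE).Cube := (graphComplex g h hcont hE).finite_cube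
  refine Nat.card_le_card_of_injective
    (fun x => (⟨⟨(g (φ x), graphOver g h (φ x) (g (φ x))), φ x, subset_rfl, rfl⟩, hd x⟩ :
      {a : (graphComplex g h hcont hE).Cube // (graphComplex g h hcont hE).dim a = d})) ?_
  intro x y hxy
  have hS : graphOver g h (φ x) (g (φ x)) = graphOver g h (φ y) (g (φ y)) :=
    congrArg (fun a => a.1.1.2) hxy
  refine hφ x y fun t ht => ?_
  have hm : (⟨(t, h (φ x) t), φ x, ht, rfl⟩ : graphUnion g h) ∈
      graphOver g h (φ x) (g (φ x)) := ⟨ht, rfl⟩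
  rw [hS] at hm
  exact hm

theorem isCoordCut_const {N : ℕ} (i : Fin N) (P : Prop) :
    IsCoordCut {_t : Fin N → unitInterval | P} := by
  by_cases hP : P
  · exact ⟨∅, by simp [hP]⟩
  · simpa [hP] using isCoordCut_empty i

theorem isCoordCut_or_coord {N : ℕ} (P : Prop) (i : Fin N) (b : Bool) :
    IsCoordCut {t : Fin N → unitInterval | P ∨ t i = endpt b} := by
  by_cases hP : P
  · exact ⟨∅, by simp [hP]⟩
  · simpa [hP] using isCoordCut_coord i b

/-! ### The walk round the square and the sheets above it. -/

/-- The facet of the cube on which the coordinate `c` equals `endpt b`. -/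
def facetCode {N : ℕ} (c : Fin N) (b : Bool) (a : Fin N) : Option Bool :=
  if a = c then some b else none

theorem mem_cubeFace_facetCode {N : ℕ} {c : Fin N} {b : Bool} {t : Fin N → unitInterval} :
    t ∈ cubeFace (facetCode c b) ↔ t c = endpt b := by
  constructor
  · exact fun h => h c b (by simp [facetCode])
  · intro h i b' hb
    unfold facetCode at hb
    split_ifs at hb with hi
    · rw [hi, h, Option.some_injective _ hb]

theorem faceDim_facetCode {N : ℕ} (c : Fin (N + 1)) (b : Bool) : faceDim (facetCode c b) = N := by
  have : freeCoords (facetCode c b) = Finset.univ.erase c := by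
    ext a
    by_cases h : a = c <;> simp [freeCoords, facetCode, h]
  simp [faceDim, this]

/-- First coordinate of the `i`-th corner when walking round the unit square. -/
def cornerX (i : ℕ) : Bool := i % 4 = 1 ∨ i % 4 = 2

/-- Second coordinate of the `i`-th corner when walking round the unit square. -/
def cornerY (i : ℕ) : Bool := i % 4 = 2 ∨ i % 4 = 3

/-- The coordinate that is constant along the `i`-th edge of the walk round the unit square. -/
def fixedCoord (k i : ℕ) : Fin (k + 3) := if i % 2 = 0 then 1 else 0

/-- The wall of the cube above the `i`-th edge of the walk. -/
def wall (k i : ℕ) : Fin (k + 3) → Option Bool := facetCode (fixedCoord k i) (cornerX i)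

/-- The position along the `i`-th edge of the walk. -/
def edgePos {k : ℕ} (i : ℕ) (t : Fin (k + 3) → unitInterval) : ℝ :=
  if i % 4 = 0 then (t 0 : ℝ) else if i % 4 = 1 then (t 1 : ℝ) else
    if i % 4 = 2 then 1 - (t 0 : ℝ) else 1 - (t 1 : ℝ)

theorem continuous_edgePos {k : ℕ} (i : ℕ) : Continuous (edgePos (k := k) i) := by
  unfold edgePos
  split_ifs <;> fun_prop

theorem edgePos_nonneg {k : ℕ} (i : ℕ) (t : Fin (k + 3) → unitInterval) : 0 ≤ edgePos i t := by
  have h₀ := (t 0).2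
  have h₁ := (t 1).2
  unfold edgePos
  split_ifs <;> linarith [h₀.1, h₀.2, h₁.1, h₁.2]

theorem edgePos_le_one {k : ℕ} (i : ℕ) (t : Fin (k + 3) → unitInterval) : edgePos i t ≤ 1 := by
  have h₀ := (t 0).2
  have h₁ := (t 1).2
  unfold edgePos
  split_ifs <;> linarith [h₀.1, h₀.2, h₁.1, h₁.2]

theorem mod_four_cases (i : ℕ) :
    (i % 4 = 0 ∧ (i + 1) % 4 = 1 ∧ i % 2 = 0 ∧ (i + 1) % 2 = 1) ∨
    (i % 4 = 1 ∧ (i + 1) % 4 = 2 ∧ i % 2 = 1 ∧ (i + 1) % 2 = 0) ∨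
    (i % 4 = 2 ∧ (i + 1) % 4 = 3 ∧ i % 2 = 0 ∧ (i + 1) % 2 = 1) ∨
    (i % 4 = 3 ∧ (i + 1) % 4 = 0 ∧ i % 2 = 1 ∧ (i + 1) % 2 = 0) := by
  omega

/-- Consecutive walls meet above corner `i + 1`, where one edge ends and the next begins. In `wall`
the label `cornerX i` serves both directions, since `cornerX i = cornerY i` for even `i`. -/
theorem edgePos_succ {k i : ℕ} {t : Fin (k + 3) → unitInterval} (h₁ : t ∈ cubeFace (wall k i))
    (h₂ : t ∈ cubeFace (wall k (i + 1))) : edgePos i t = 1 ∧ edgePos (i + 1) t = 0 := by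
  rw [wall, mem_cubeFace_facetCode] at h₁ h₂
  rcases mod_four_cases i with h | h | h | h <;> obtain ⟨a, b, c, d⟩ := h <;>
    simp_all [fixedCoord, cornerX, edgePos, endpt]

/-- The sheets of the construction: `m` squares, and `m` walls along each of the `L` edges of
the path. -/
abbrev Sheet (m L : ℕ) : Type := Fin m ⊕ Fin m × Fin L

/-- The face of the cube over which a sheet lies. -/
def sheetCode (k : ℕ) {m L : ℕ} : Sheet m L → Fin (k + 3) → Option Bool
  | .inl _ => facetCode 2 true
  | .inr (_, i) => wall k i

/-- The function of which a sheet is the graph. Its components record the position on the path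
and the number of the copy. -/
def sheetMap (k : ℕ) {m L : ℕ} : Sheet m L → (Fin (k + 3) → unitInterval) → ℝ × ℝ
  | .inl x, _ => (0, (x : ℝ) + 1)
  | .inr (x, i), t => ((1 - (t 2 : ℝ)) * (i + edgePos i t), (t 2 : ℝ) * (x + 1))

theorem continuous_sheetMap (k : ℕ) {m L : ℕ} (j : Sheet m L) : Continuous (sheetMap k j) := by
  rcases j with x | ⟨x, i⟩
  · exact continuous_const
  · have := continuous_edgePos (k := k) i
    unfold sheetMap
    fun_prop

theorem faceDim_sheetCode (k : ℕ) {m L : ℕ} (j : Sheet m L) :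
    faceDim (sheetCode k j) = k + 2 := by
  rcases j with x | ⟨x, i⟩ <;> exact faceDim_facetCode _ _

/-- The factors `1 - t 2` and `t 2` erase the path position at the top and the copy number at the
bottom. Elsewhere the positions `i + edgePos i t` must agree, which for `t` in both walls means
equal or consecutive edges. -/
theorem sheetMap_inr_eq_iff {k m L : ℕ} {x x' : Fin m} {i i' : Fin L}
    {t : Fin (k + 3) → unitInterval} (h : t ∈ cubeFace (wall k i))
    (h' : t ∈ cubeFace (wall k i')) :
    sheetMap k (.inr (x, i)) t = sheetMap k (.inr (x', i')) t ↔
      (((i : ℕ) ≤ i' + 1 ∧ (i' : ℕ) ≤ i + 1) ∨ t 2 = endpt true) ∧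
      (x = x' ∨ t 2 = endpt false) := by
  have e₁ : t 2 = endpt true ↔ (1 : ℝ) - t 2 = 0 := by
    rw [sub_eq_zero, eq_comm, Subtype.ext_iff]; simp [endpt]
  have e₂ : t 2 = endpt false ↔ (t 2 : ℝ) = 0 := by rw [Subtype.ext_iff]; simp [endpt]
  have e₃ : (i : ℝ) + edgePos i t = i' + edgePos i' t ↔ ((i : ℕ) ≤ i' + 1 ∧ (i' : ℕ) ≤ i + 1) := by
    constructor
    · intro he
      have := edgePos_nonneg i t
      have := edgePos_nonneg i' t
      have := edgePos_le_one i t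
      have := edgePos_le_one i' t
      exact ⟨by exact_mod_cast (by linarith : (i : ℝ) ≤ i' + 1),
        by exact_mod_cast (by linarith : (i' : ℝ) ≤ i + 1)⟩
    · rintro ⟨h₁, h₂⟩
      rcases (by omega : (i : ℕ) = i' ∨ (i' : ℕ) = i + 1 ∨ (i : ℕ) = i' + 1) with he | he | he
      · rw [he]
      · rw [he] at h' ⊢
        obtain ⟨p, q⟩ := edgePos_succ h h'
        rw [p, q]; push_cast; ring
      · rw [he] at h ⊢
        obtain ⟨p, q⟩ := edgePos_succ h' h
        rw [p, q]; push_cast; ring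
  simp only [sheetMap, Prod.mk.injEq, mul_eq_mul_left_iff, e₁, e₂, e₃, add_left_inj,
    Nat.cast_inj, Fin.val_inj]

theorem isCoordCut_sheet (k : ℕ) {m L : ℕ} (i j : Sheet m L) :
    IsCoordCut {t | t ∈ cubeFace (sheetCode k i) ∧ t ∈ cubeFace (sheetCode k j) ∧
      sheetMap k i t = sheetMap k j t} := by
  have hmixed : ∀ (x x' : Fin m) (i : Fin L) (t : Fin (k + 3) → unitInterval),
      t ∈ cubeFace (facetCode 2 true) →
      (sheetMap k (.inl x : Sheet m L) t = sheetMap k (.inr (x', i)) t ↔ x = x') := by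
    intro x x' i t ht
    rw [mem_cubeFace_facetCode] at ht
    simp [sheetMap, ht, endpt, Fin.val_inj]
  rcases i with x | ⟨x, i⟩ <;> rcases j with x' | ⟨x', i'⟩
  · convert (isCoordCut_cubeFace (facetCode (2 : Fin (k + 3)) true)).inter
      (isCoordCut_const (0 : Fin (k + 3)) (x = x')) using 1
    ext t
    simp [sheetCode, sheetMap, Fin.val_inj]
  · convert (isCoordCut_cubeFace (facetCode (2 : Fin (k + 3)) true)).inter
      ((isCoordCut_cubeFace (wall k i')).inter
      (isCoordCut_const (0 : Fin (k + 3)) (x = x'))) using 1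
    ext t
    exact and_congr_right fun h => and_congr_right fun _ => hmixed x x' i' t h
  · convert (isCoordCut_cubeFace (wall k i)).inter
      ((isCoordCut_cubeFace (facetCode (2 : Fin (k + 3)) true)).inter
      (isCoordCut_const (0 : Fin (k + 3)) (x' = x))) using 1
    ext t
    exact and_congr_right fun _ => and_congr_right fun h => eq_comm.trans (hmixed x' x i t h)
  · convert (isCoordCut_cubeFace (wall k i)).inter ((isCoordCut_cubeFace (wall k i')).inter
      ((isCoordCut_or_coord ((i : ℕ) ≤ i' + 1 ∧ (i' : ℕ) ≤ i + 1) (2 : Fin (k + 3)) true).inter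
      (isCoordCut_or_coord (x = x') (2 : Fin (k + 3)) false))) using 1
    ext t
    exact and_congr_right fun h => and_congr_right fun h' => sheetMap_inr_eq_iff h h'

/-! ### Dimension, facets and vertices of the complex. -/

/-- The cube complex made of the sheets. -/
noncomputable def sheetComplex (k m L : ℕ) :
    CubeComplex (graphUnion (sheetCode k (m := m) (L := L)) (sheetMap k)) :=
  graphComplex _ _ (continuous_sheetMap k) (isCoordCut_sheet k)

theorem sheetComplex_hasDimension (k : ℕ) {m L : ℕ} (hm : 0 < m) :
    (sheetComplex k m L).HasDimension (k + 2) :=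
  have : Nonempty (Sheet m L) := ⟨.inl ⟨0, hm⟩⟩
  graphComplex_hasDimension _ _ _ _ (faceDim_sheetCode k)

theorem le_sheetComplex_numFacets (k m L : ℕ) :
    m * L ≤ (sheetComplex k m L).numFacets (k + 2) := by
  have := graphComplex_le_numFacets (I := Fin m × Fin L) (sheetCode k (m := m) (L := L))
    (sheetMap k) (continuous_sheetMap k) (isCoordCut_sheet k) (d := k + 2) Sum.inr
    (fun _ => faceDim_sheetCode k _) ?_
  · simpa [sheetComplex] using this
  rintro ⟨x, i⟩ ⟨x', i'⟩ h
  -- At the midpoint of a wall the path position is `i + 1/2` and the height is 1/2, which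
  -- determines both `i` and `x`.
  obtain ⟨h₁, h₂⟩ := h _ (faceMid_mem _)
  rw [sheetMap, sheetMap] at h₂
  have h2 : ((faceMid (wall k i) 2 : unitInterval) : ℝ) = 1 / 2 := by
    have : wall k i 2 = none := by
      unfold wall facetCode fixedCoord
      split_ifs <;> simp_all [Fin.ext_iff, Nat.mod_eq_of_lt]
    simp [faceMid, this]
  have hpos : edgePos i (faceMid (wall k i)) = 1 / 2 := by
    rcases mod_four_cases i with h | h | h | h <;> obtain ⟨a, b, c, d⟩ := h <;>
      norm_num [edgePos, faceMid, wall, facetCode, fixedCoord, a, c]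
  simp only [sheetCode] at h₂
  rw [h2, hpos, Prod.mk.injEq] at h₂
  have := edgePos_nonneg i' (faceMid (wall k i))
  have := edgePos_le_one i' (faceMid (wall k i))
  have hi₁ : (i : ℕ) < i' + 1 := by exact_mod_cast (by linarith : (i : ℝ) < i' + 1)
  have hi₂ : (i' : ℕ) < i + 1 := by exact_mod_cast (by linarith : (i' : ℝ) < i + 1)
  have hx : (x : ℕ) = x' := by exact_mod_cast (by linarith : (x : ℝ) = x')
  exact Prod.ext (Fin.ext hx) (Fin.ext (by dsimp only; omega))

/-- The vertices of the complex made of the sheets. -/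
def sheetVertex (k m L : ℕ) :
    (Fin k → Bool) × (Bool × Bool × Fin m ⊕ Fin (L + 1)) → (Fin (k + 3) → Bool) × (ℝ × ℝ)
  | (r, .inl (a, b, x)) => (Fin.cons a (Fin.cons b (Fin.cons true r)), 0, (x : ℝ) + 1)
  | (r, .inr i) => (Fin.cons (cornerX i) (Fin.cons (cornerY i) (Fin.cons false r)), (i : ℝ), 0)

theorem eq_cons_cons_cons {k : ℕ} {α : Type} (b : Fin (k + 3) → α) {p q r : α} (h₀ : b 0 = p)
    (h₁ : b 1 = q) (h₂ : b 2 = r) : (Fin.cons p (Fin.cons q (Fin.cons r fun a =>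
      b a.succ.succ.succ)) : Fin (k + 3) → α) = b := by
  subst h₀ h₁ h₂
  ext a
  refine Fin.cases ?_ (fun a => Fin.cases ?_ (fun a => Fin.cases ?_ (fun a => ?_) a) a) a
  all_goals rfl

theorem exists_corner_edgePos {k i : ℕ} {b : Fin (k + 3) → Bool}
    (h : (fun a => endpt (b a)) ∈ cubeFace (wall k i)) :
    (edgePos (k := k) i (fun a => endpt (b a)) = 0 ∧ b 0 = cornerX i ∧ b 1 = cornerY i) ∨
    (edgePos (k := k) i (fun a => endpt (b a)) = 1 ∧ b 0 = cornerX (i + 1) ∧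
      b 1 = cornerY (i + 1)) := by
  rw [wall, mem_cubeFace_facetCode] at h
  replace h := endpt_injective h
  rcases mod_four_cases i with h' | h' | h' | h' <;> obtain ⟨a, a', c, c'⟩ := h' <;>
    cases hb : b 0 <;> cases hb' : b 1 <;>
    simp [fixedCoord, cornerX, cornerY, edgePos, endpt, a, a', c, hb, hb'] at h ⊢

/-- Above each corner of `[0,1]^k` there are four top vertices per copy and `L + 1` bottom vertices,
the latter shared by all copies. -/
theorem sheetComplex_numVertices_le (k m L : ℕ) :
    (sheetComplex k m L).numVertices ≤ 2 ^ k * (4 * m + (L + 1)) := by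
  have := graphComplex_numVertices_le (sheetCode k (m := m) (L := L))
    (sheetMap k) (continuous_sheetMap k) (isCoordCut_sheet k) (sheetVertex k m L) ?_
  · refine this.trans (le_of_eq ?_)
    simp [Nat.card_eq_fintype_card]
    ring
  rintro (x | ⟨x, i⟩) b hb
  · refine ⟨(_, .inl (b 0, b 1, x)), Prod.ext (eq_cons_cons_cons b rfl rfl ?_) rfl⟩
    exact endpt_injective (mem_cubeFace_facetCode.1 hb)
  · rcases h2 : b 2 with _ | _
    · rcases exists_corner_edgePos hb with ⟨h, h0, h1⟩ | ⟨h, h0, h1⟩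
      · refine ⟨(_, .inr i.castSucc), Prod.ext (eq_cons_cons_cons b h0 h1 h2) ?_⟩
        simp only [sheetMap, sheetVertex, h, h2]
        simp [endpt]
      · refine ⟨(_, .inr i.succ), Prod.ext (eq_cons_cons_cons b h0 h1 h2) ?_⟩
        simp only [sheetMap, sheetVertex, h, h2]
        simp [endpt]
    · refine ⟨(_, .inl (b 0, b 1, x)), Prod.ext (eq_cons_cons_cons b rfl rfl h2) ?_⟩
      simp [sheetMap, sheetVertex, h2, endpt]

/-! ### Homotopies induced on a quotient. -/

/-- Continuous families of maps on a compact space that are compatible with a quotient map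
induce homotopies on the quotient. -/
theorem exists_homotopic_of_compact_surjection {W X : Type} [TopologicalSpace W] [CompactSpace W]
    [TopologicalSpace X] [T2Space X] {q : W → X} (hq : Continuous q)
    (hsurj : Function.Surjective q) (f : C(X, X)) (F : unitInterval → W → X)
    (hF : Continuous fun p : unitInterval × W => F p.1 p.2)
    (hcomp : ∀ t w w', q w = q w' → F t w = F t w') (h0 : ∀ w, F 0 w = f (q w)) :
    ∃ f' : C(X, X), f.Homotopic f' ∧ ∀ w, f' (q w) = F 1 w := by
  -- A continuous surjection from a compact space to a Hausdorff space is a quotient map; applied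
  -- after multiplying by the interval, this makes the induced homotopy jointly continuous.
  have hQ : Topology.IsQuotientMap
      (⟨Prod.map id q, continuous_id.prodMap hq⟩ : C(unitInterval × W, unitInterval × X)) :=
    .of_surjective_continuous (Function.surjective_id.prodMap hsurj) (continuous_id.prodMap hq)
  have hfac : Function.FactorsThrough (⟨fun p => F p.1 p.2, hF⟩ : C(unitInterval × W, X))
      (⟨Prod.map id q, continuous_id.prodMap hq⟩ : C(unitInterval × W, unitInterval × X)) := by
    rintro ⟨t, w⟩ ⟨t', w'⟩ h
    obtain ⟨h₁, h₂⟩ := Prod.ext_iff.1 h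
    dsimp at h₁ h₂ ⊢
    subst h₁
    exact hcomp _ _ _ h₂
  have hlift : ∀ t w, hQ.lift _ hfac (t, q w) = F t w := fun t w =>
    DFunLike.congr_fun (hQ.lift_comp _ hfac) (t, w)
  refine ⟨(hQ.lift _ hfac).comp (.prodMk (.const _ 1) (.id _)),
    ⟨⟨hQ.lift _ hfac, fun x => ?_, fun x => rfl⟩⟩, fun w => hlift 1 w⟩
  obtain ⟨w, rfl⟩ := hsurj x
  exact (hlift 0 w).trans (h0 w)

/-! ### Parametrization of the sheets by path position and height. -/

/-- Piecewise linear interpolation of the values `c 0, …, c L` at `0, …, L`. -/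
noncomputable def interp (c : ℕ → ℝ) (L : ℕ) (z : ℝ) : ℝ :=
  c 0 + ∑ j ∈ Finset.range L, (c (j + 1) - c j) * max 0 (min 1 (z - j))

theorem continuous_interp (c : ℕ → ℝ) (L : ℕ) : Continuous (interp c L) := by
  unfold interp
  fun_prop

theorem interp_of_le (c : ℕ → ℝ) {L : ℕ} {z : ℝ} (h : (L : ℝ) ≤ z) : interp c L z = c L := by
  induction L with
  | zero => simp [interp]
  | succ L ih =>
    push_cast at h
    have := ih (by linarith)
    rw [interp] at this
    rw [interp, Finset.sum_range_succ, ← add_assoc, this, min_eq_left (by linarith),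
      max_eq_right (by norm_num)]
    ring

theorem interp_nat_add (c : ℕ → ℝ) {L i : ℕ} (hi : i < L) {τ : ℝ} (h₀ : 0 ≤ τ) (h₁ : τ ≤ 1) :
    interp c L (i + τ) = c i + (c (i + 1) - c i) * τ := by
  induction L with
  | zero => omega
  | succ L ih =>
    rw [interp, Finset.sum_range_succ, ← add_assoc, ← interp]
    rcases Nat.lt_succ_iff_lt_or_eq.1 hi with h | rfl
    · have : (i : ℝ) + 1 ≤ L := by exact_mod_cast h
      rw [ih h, max_eq_left ((min_le_right _ _).trans (by linarith)), mul_zero, add_zero]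
    · rw [interp_of_le c (by linarith), add_sub_cancel_left, min_eq_right h₁, max_eq_right h₀]

theorem exists_nat_add {L : ℕ} (hL : 0 < L) {z : ℝ} (h₀ : 0 ≤ z) (h₁ : z ≤ L) :
    ∃ i < L, ∃ τ : ℝ, 0 ≤ τ ∧ τ ≤ 1 ∧ z = i + τ := by
  rcases h₁.lt_or_eq with h | h
  · exact ⟨⌊z⌋₊, (Nat.floor_lt h₀).2 h, z - ⌊z⌋₊, by linarith [Nat.floor_le h₀],
      by linarith [Nat.lt_floor_add_one z], by ring⟩
  -- The right end belongs to the last interval with `τ = 1`, since its floor `L` is not a valid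
  -- index.
  · refine ⟨L - 1, by omega, 1, by norm_num, le_rfl, ?_⟩
    rw [h, Nat.cast_sub hL]
    simp

/-- First coordinate of the walk round the unit square. -/
noncomputable def walkX (L : ℕ) : ℝ → ℝ := interp (fun i => (endpt (cornerX i) : ℝ)) L

/-- Second coordinate of the walk round the unit square. -/
noncomputable def walkY (L : ℕ) : ℝ → ℝ := interp (fun i => (endpt (cornerY i) : ℝ)) L

theorem interp_mem_unitInterval {c : ℕ → ℝ} (hc : ∀ i, c i ∈ unitInterval) {L : ℕ} (hL : 0 < L)
    {z : ℝ} (h₀ : 0 ≤ z) (h₁ : z ≤ L) : interp c L z ∈ unitInterval := by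
  obtain ⟨i, hi, τ, hτ₀, hτ₁, rfl⟩ := exists_nat_add hL h₀ h₁
  rw [interp_nat_add c hi hτ₀ hτ₁]
  have h := hc i
  have h' := hc (i + 1)
  constructor
  · nlinarith [h.1, h'.1]
  · nlinarith [h.2, h'.2]

theorem mem_wall_and_edgePos_eq_iff {k i : ℕ} {t : Fin (k + 3) → unitInterval} {τ : ℝ} :
    t ∈ cubeFace (wall k i) ∧ edgePos i t = τ ↔
      (t 0 : ℝ) = endpt (cornerX i) + ((endpt (cornerX (i + 1)) : ℝ) - endpt (cornerX i)) * τ ∧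
      (t 1 : ℝ) = endpt (cornerY i) + ((endpt (cornerY (i + 1)) : ℝ) - endpt (cornerY i)) * τ := by
  rw [wall, mem_cubeFace_facetCode, Subtype.ext_iff]
  rcases mod_four_cases i with h | h | h | h <;> obtain ⟨a, b, c, d⟩ := h <;>
    simp [fixedCoord, cornerX, cornerY, edgePos, endpt, a, b, c]
  · exact and_comm
  · rw [and_comm]
    exact and_congr_left' ⟨fun h => by linarith, fun h => by linarith⟩
  · exact fun _ => ⟨fun h => by linarith, fun h => by linarith⟩

/-- The point at height `s` over the position `z` of the path in the copy number `x` of the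
mapping cylinder, extended to `s ≤ 2` by coning off the walk round the square. -/
noncomputable def sheetPoint {k : ℕ} (L : ℕ) (x z s : ℝ) (r : Fin k → unitInterval) :
    (Fin (k + 3) → unitInterval) × (ℝ × ℝ) :=
  (Fin.cons (Set.projIcc 0 1 zero_le_one (min 1 (2 - s) * walkX L z))
    (Fin.cons (Set.projIcc 0 1 zero_le_one (min 1 (2 - s) * walkY L z))
      (Fin.cons (Set.projIcc 0 1 zero_le_one (min 1 s)) r)),
    (1 - min 1 s) * z, min 1 s * (x + 1))

theorem continuous_finCons {T α : Type} [TopologicalSpace T] [TopologicalSpace α] {n : ℕ}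
    {f : T → α} {g : T → Fin n → α} (hf : Continuous f) (hg : Continuous g) :
    Continuous fun a => (Fin.cons (f a) (g a) : Fin (n + 1) → α) :=
  continuous_iff_continuousAt.2 fun _ => hf.continuousAt.finCons hg.continuousAt

theorem continuous_sheetPoint {T : Type} [TopologicalSpace T] {k : ℕ} (L : ℕ) {x z s : T → ℝ}
    {r : T → Fin k → unitInterval} (hx : Continuous x) (hz : Continuous z) (hs : Continuous s)
    (hr : Continuous r) : Continuous fun a => sheetPoint L (x a) (z a) (s a) (r a) := by
  have hX := (continuous_interp (fun i => (endpt (cornerX i) : ℝ)) L).comp hz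
  have hY := (continuous_interp (fun i => (endpt (cornerY i) : ℝ)) L).comp hz
  refine .prodMk (continuous_finCons (continuous_projIcc.comp ?_) (continuous_finCons
    (continuous_projIcc.comp ?_) (continuous_finCons (continuous_projIcc.comp ?_) hr))) ?_
  · exact (continuous_const.min (continuous_const.sub hs)).mul hX
  · exact (continuous_const.min (continuous_const.sub hs)).mul hY
  all_goals fun_prop

/-- Up to `s = 1` the point is on a wall at height `s`; from there on it is in the top square,
scaled towards the origin by `2 - s`. -/
theorem sheetPoint_mem {k m L : ℕ} (hL : 0 < L) (x : Fin m) {z s : ℝ} (hz : z ∈ Set.Icc 0 (L : ℝ))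
    (hs : s ∈ Set.Icc (0 : ℝ) 2) (r : Fin k → unitInterval) :
    sheetPoint L x z s r ∈ graphUnion (sheetCode k (m := m) (L := L)) (sheetMap k) := by
  rcases le_total s 1 with h | h
  · have hX : walkX L z ∈ unitInterval :=
      interp_mem_unitInterval (fun i => (endpt (cornerX i)).2) hL hz.1 hz.2
    have hY : walkY L z ∈ unitInterval :=
      interp_mem_unitInterval (fun i => (endpt (cornerY i)).2) hL hz.1 hz.2
    obtain ⟨i, hi, τ, hτ₀, hτ₁, hzi⟩ := exists_nat_add hL hz.1 hz.2
    have hw := (mem_wall_and_edgePos_eq_iff (k := k) (i := i) (τ := τ)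
      (t := (sheetPoint L x z s r).1)).2 ?_
    · refine ⟨.inr (x, ⟨i, hi⟩), hw.1, ?_⟩
      simp only [sheetMap, hw.2]
      have : (((sheetPoint L x z s r).1 2 : unitInterval) : ℝ) = s := by
        change ((Set.projIcc (0 : ℝ) 1 zero_le_one (min 1 s) : unitInterval) : ℝ) = s
        rw [min_eq_right h, Set.projIcc_of_mem _ ⟨hs.1, h⟩]
      rw [this]
      simp [sheetPoint, h, hzi]
    · have e : min 1 (2 - s) = 1 := min_eq_left (by linarith)
      constructor
      · change ((Set.projIcc (0 : ℝ) 1 zero_le_one (min 1 (2 - s) * walkX L z) : unitInterval) : ℝ)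
          = _
        rw [e, one_mul, Set.projIcc_of_mem _ hX]
        change walkX L z = _
        rw [walkX, hzi, interp_nat_add _ hi hτ₀ hτ₁]
      · change ((Set.projIcc (0 : ℝ) 1 zero_le_one (min 1 (2 - s) * walkY L z) : unitInterval) : ℝ)
          = _
        rw [e, one_mul, Set.projIcc_of_mem _ hY]
        change walkY L z = _
        rw [walkY, hzi, interp_nat_add _ hi hτ₀ hτ₁]
  · refine ⟨.inl x, mem_cubeFace_facetCode.2 ?_, ?_⟩
    · change Set.projIcc (0 : ℝ) 1 zero_le_one (min 1 s) = _
      rw [min_eq_left h, Set.projIcc_right]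
      rfl
    · simp [sheetPoint, sheetMap, h]

/-- The ray from the origin through `(a, b)` leaves the square on edge 1 if `b ≤ a` and on edge 2
otherwise. Coning off these two edges from the corner `(0, 0)` fills the square, which is why three
edges of path suffice. -/
theorem exists_cone_walk {L : ℕ} (hL : 3 ≤ L) (a b : unitInterval) :
    ∃ z ∈ Set.Icc 0 (L : ℝ), ∃ s ∈ Set.Icc (1 : ℝ) 2,
      (2 - s) * walkX L z = a ∧ (2 - s) * walkY L z = b := by
  have hL' : (3 : ℝ) ≤ L := by exact_mod_cast hL
  have ha := a.2
  have hb := b.2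
  rcases le_or_gt (b : ℝ) a with h | h
  · rcases ha.1.eq_or_lt with h0 | h0
    · exact ⟨0, ⟨le_rfl, by linarith⟩, 2, by norm_num, by linarith, by linarith [hb.1]⟩
    · have h₀ : (0 : ℝ) ≤ b / a := div_nonneg hb.1 ha.1
      have h₁ : (b / a : ℝ) ≤ 1 := (div_le_one h0).2 h
      refine ⟨((1 : ℕ) : ℝ) + b / a, ⟨by push_cast; linarith, by push_cast; linarith⟩, 2 - a,
        ⟨by linarith [ha.2], by linarith⟩, ?_, ?_⟩
      · rw [walkX, interp_nat_add _ (by omega) h₀ h₁]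
        simp [cornerX, endpt]
      · rw [walkY, interp_nat_add _ (by omega) h₀ h₁]
        simp [cornerY, endpt]
        field_simp
  · have h0 : (0 : ℝ) < b := ha.1.trans_lt h
    have h₀ : (0 : ℝ) ≤ 1 - a / b := sub_nonneg.2 ((div_le_one h0).2 h.le)
    have h₁ : (1 - a / b : ℝ) ≤ 1 := by linarith [div_nonneg ha.1 hb.1]
    refine ⟨((2 : ℕ) : ℝ) + (1 - a / b), ⟨by push_cast; linarith, by push_cast; linarith⟩, 2 - b,
      ⟨by linarith [hb.2], by linarith⟩, ?_, ?_⟩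
    · rw [walkX, interp_nat_add _ (by omega) h₀ h₁]
      simp [cornerX, endpt]
      field_simp
    · rw [walkY, interp_nat_add _ (by omega) h₀ h₁]
      simp [cornerY, endpt]

theorem exists_sheetPoint_eq {k m L : ℕ} (hL : 3 ≤ L) {p : (Fin (k + 3) → unitInterval) × (ℝ × ℝ)}
    (hp : p ∈ graphUnion (sheetCode k (m := m) (L := L)) (sheetMap k)) :
    ∃ (x : Fin m), ∃ z ∈ Set.Icc 0 (L : ℝ), ∃ s ∈ Set.Icc (0 : ℝ) 2, ∃ r : Fin k → unitInterval,
      sheetPoint L x z s r = p := by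
  obtain ⟨t, y⟩ := p
  obtain ⟨x | ⟨x, i⟩, ht, hy⟩ := hp <;> dsimp only at ht hy
  · obtain ⟨z, hz, s, hs, h₀, h₁⟩ := exists_cone_walk hL (t 0) (t 1)
    refine ⟨x, z, hz, s, ⟨by linarith [hs.1], hs.2⟩, fun a => t a.succ.succ.succ, ?_⟩
    have e : min 1 (2 - s) = 2 - s := min_eq_right (by linarith [hs.1])
    refine Prod.ext (eq_cons_cons_cons t ?_ ?_ ?_) ?_
    · rw [e, h₀, Set.projIcc_val]
    · rw [e, h₁, Set.projIcc_val]
    · rw [mem_cubeFace_facetCode.1 ht, min_eq_left hs.1, Set.projIcc_right]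
      rfl
    · simp [sheetPoint, hy, sheetMap, hs.1]
  · obtain ⟨h₀, h₁⟩ := mem_wall_and_edgePos_eq_iff.1 ⟨ht, rfl⟩
    have hτ₀ := edgePos_nonneg i t
    have hτ₁ := edgePos_le_one i t
    have hi : ((i : ℕ) : ℝ) + 1 ≤ L := by exact_mod_cast i.2
    have hs := (t 2).2
    refine ⟨x, i + edgePos i t, ⟨by positivity, by linarith⟩, t 2, ⟨hs.1, by linarith [hs.2]⟩,
      fun a => t a.succ.succ.succ, ?_⟩
    have e : min 1 (2 - (t 2 : ℝ)) = 1 := min_eq_left (by linarith [hs.2])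
    refine Prod.ext (eq_cons_cons_cons t ?_ ?_ ?_) ?_
    · rw [e, one_mul, walkX, interp_nat_add _ i.2 hτ₀ hτ₁, ← h₀, Set.projIcc_val]
    · rw [e, one_mul, walkY, interp_nat_add _ i.2 hτ₀ hτ₁, ← h₁, Set.projIcc_val]
    · rw [min_eq_right hs.2, Set.projIcc_val]
    · simp [sheetPoint, hy, sheetMap, hs.2]

/-- These are all the identifications that a homotopy on the parameters must respect: copies merge
at `s = 0`, and for `s ≥ 1` only the scaled walk point counts. -/
theorem sheetPoint_eq_sheetPoint {k L : ℕ} (hL : 0 < L) {x x' z z' s s' : ℝ}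
    {r r' : Fin k → unitInterval} (hz : z ∈ Set.Icc 0 (L : ℝ)) (hz' : z' ∈ Set.Icc 0 (L : ℝ))
    (hs : s ∈ Set.Icc (0 : ℝ) 2) (hs' : s' ∈ Set.Icc (0 : ℝ) 2)
    (h : sheetPoint L x z s r = sheetPoint L x' z' s' r') :
    r = r' ∧ ((s = s' ∧ z = z' ∧ (s = 0 ∨ x = x')) ∨
      (1 ≤ s ∧ 1 ≤ s' ∧ x = x' ∧ (2 - s) * walkX L z = (2 - s') * walkX L z' ∧
        (2 - s) * walkY L z = (2 - s') * walkY L z')) := by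
  have hX : ∀ z ∈ Set.Icc 0 (L : ℝ), walkX L z ∈ unitInterval := fun z hz =>
    interp_mem_unitInterval (fun i => (endpt (cornerX i)).2) hL hz.1 hz.2
  have hY : ∀ z ∈ Set.Icc 0 (L : ℝ), walkY L z ∈ unitInterval := fun z hz =>
    interp_mem_unitInterval (fun i => (endpt (cornerY i)).2) hL hz.1 hz.2
  simp only [sheetPoint, Prod.mk.injEq, Fin.cons_inj] at h
  obtain ⟨⟨h₀, h₁, h₂, hr⟩, h₃, h₄⟩ := h
  refine ⟨hr, ?_⟩
  have hmin : ∀ s ∈ Set.Icc (0 : ℝ) 2, min 1 s ∈ unitInterval := fun s hs =>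
    ⟨le_min zero_le_one hs.1, min_le_left _ _⟩
  have h₂' : min 1 s = min 1 s' := by
    rw [Set.projIcc_of_mem _ (hmin s hs), Set.projIcc_of_mem _ (hmin s' hs')] at h₂
    exact congrArg Subtype.val h₂
  rcases lt_or_ge s 1 with h | h
  · left
    rw [min_eq_right h.le] at h₂' h₃ h₄
    have h' : s = s' := by
      rcases min_cases 1 s' with ⟨e, -⟩ | ⟨e, -⟩ <;> rw [e] at h₂' <;> linarith
    subst h'
    rw [min_eq_right h.le] at h₃ h₄
    refine ⟨rfl, mul_left_cancel₀ (by linarith) h₃, ?_⟩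
    rcases mul_eq_mul_left_iff.1 h₄ with h | h
    · exact .inr (by linarith)
    · exact .inl h
  · right
    rw [min_eq_left h] at h₂'
    have h' : 1 ≤ s' := by rw [h₂']; exact min_le_right _ _
    rw [min_eq_left h, min_eq_left h'] at h₄
    have key : ∀ s ∈ Set.Icc (0 : ℝ) 2, 1 ≤ s → ∀ y ∈ unitInterval,
        ((Set.projIcc (0 : ℝ) 1 zero_le_one (min 1 (2 - s) * y) : unitInterval) : ℝ)
          = (2 - s) * y := by
      intro s hs h y hy
      rw [min_eq_right (by linarith), Set.projIcc_of_mem]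
      exact ⟨mul_nonneg (by linarith [hs.2]) hy.1,
        mul_le_one₀ (by linarith) hy.1 hy.2⟩
    refine ⟨h, h', by linarith, ?_, ?_⟩
    · rw [← key s hs h _ (hX z hz), ← key s' hs' h' _ (hX z' hz'), h₀]
    · rw [← key s hs h _ (hY z hz), ← key s' hs' h' _ (hY z' hz'), h₁]

theorem sheetPoint_zero {k L : ℕ} (x x' z : ℝ) (r : Fin k → unitInterval) :
    sheetPoint L x z 0 r = sheetPoint L x' z 0 r := by
  simp [sheetPoint]

theorem sheetPoint_congr {k L : ℕ} {x z z' s s' : ℝ} (r : Fin k → unitInterval) (hs : 1 ≤ s)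
    (hs' : 1 ≤ s') (hX : (2 - s) * walkX L z = (2 - s') * walkX L z')
    (hY : (2 - s) * walkY L z = (2 - s') * walkY L z') :
    sheetPoint L x z s r = sheetPoint L x z' s' r := by
  have e : min 1 (2 - s) = 2 - s := min_eq_right (by linarith)
  have e' : min 1 (2 - s') = 2 - s' := min_eq_right (by linarith)
  simp only [sheetPoint, e, e', min_eq_left hs, min_eq_left hs', hX, hY, sub_self, zero_mul]

theorem sheetPoint_two {k L : ℕ} (x z z' : ℝ) (r : Fin k → unitInterval) :
    sheetPoint L x z 2 r = sheetPoint L x z' 2 r :=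
  sheetPoint_congr r (by norm_num) (by norm_num) (by simp) (by simp)

/-! ### Contractibility of the union of the sheets. -/

/-- The parameter space of the points of the sheets. -/
abbrev SheetParam (k m L : ℕ) : Type :=
  Fin m × Set.Icc 0 (L : ℝ) × Set.Icc (0 : ℝ) 2 × (Fin k → unitInterval)

theorem contractibleSpace_sheets (k : ℕ) {m L : ℕ} (hm : 0 < m) (hL : 3 ≤ L) :
    ContractibleSpace (graphUnion (sheetCode k (m := m) (L := L)) (sheetMap k)) := by
  have hL0 : 0 < L := by omega
  let q : SheetParam k m L → graphUnion (sheetCode k (m := m) (L := L)) (sheetMap k) := fun w =>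
    ⟨sheetPoint L w.1 w.2.1 w.2.2.1 w.2.2.2, sheetPoint_mem hL0 w.1 w.2.1.2 w.2.2.1.2 w.2.2.2⟩
  have hcast : Continuous fun x : Fin m => (x : ℝ) := continuous_of_discreteTopology
  have hq : Continuous q := by
    refine Continuous.subtype_mk (continuous_sheetPoint L ?_ ?_ ?_ ?_) _ <;> fun_prop
  have hsurj : Function.Surjective q := by
    rintro ⟨p, hp⟩
    obtain ⟨x, z, hz, s, hs, r, h⟩ := exists_sheetPoint_eq hL hp
    exact ⟨(x, ⟨z, hz⟩, ⟨s, hs⟩, r), Subtype.ext h⟩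
  have hfib : ∀ w w' : SheetParam k m L, q w = q w' → _ := fun w w' h =>
    sheetPoint_eq_sheetPoint hL0 w.2.1.2 w'.2.1.2 w.2.2.1.2 w'.2.2.1.2 (congrArg Subtype.val h)
  have hz : ∀ (t : unitInterval) (z : Set.Icc 0 (L : ℝ)),
      (1 - (t : ℝ)) * z ∈ Set.Icc 0 (L : ℝ) := fun t z =>
    ⟨mul_nonneg (by linarith [t.2.2]) z.2.1, by nlinarith [t.2.1, t.2.2, z.2.1, z.2.2]⟩
  -- This height moves from `s` to `min (2 * s) 2`. For `s ≥ 1` the second term is the minimum, and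
  -- subtracting it from 2 gives `(1 - t) * (2 - s)`, so the scaled walk points are simply
  -- multiplied by `1 - t`.
  have hs₁ : ∀ (t : unitInterval) (s : Set.Icc (0 : ℝ) 2),
      min ((1 + (t : ℝ)) * s) (s + 2 * t - t * s) ∈ Set.Icc (0 : ℝ) 2 := fun t s =>
    ⟨le_min (mul_nonneg (by linarith [t.2.1]) s.2.1) (by nlinarith [t.2.1, t.2.2, s.2.1, s.2.2]),
      (min_le_right _ _).trans (by nlinarith [t.2.1, t.2.2, s.2.1, s.2.2])⟩
  have hs₂ : ∀ s : Set.Icc (0 : ℝ) 2, min (2 * (s : ℝ)) 2 ∈ Set.Icc (0 : ℝ) 2 := fun s =>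
    ⟨le_min (by linarith [s.2.1]) zero_le_two, min_le_right _ _⟩
  have hs₃ : ∀ (t : unitInterval) (s : Set.Icc (0 : ℝ) 2),
      (1 - (t : ℝ)) * min (2 * (s : ℝ)) 2 ∈ Set.Icc (0 : ℝ) 2 := fun t s =>
    ⟨mul_nonneg (by linarith [t.2.2]) (hs₂ s).1,
      by nlinarith [t.2.1, t.2.2, (hs₂ s).1, (hs₂ s).2]⟩
  -- Each top square shrinks to its cone point, dragging the walls up behind it.
  obtain ⟨f₁, hf₁, hf₁'⟩ := exists_homotopic_of_compact_surjection hq hsurj (.id _)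
    (fun t w => ⟨sheetPoint L w.1 w.2.1 (min ((1 + (t : ℝ)) * w.2.2.1)
      (w.2.2.1 + 2 * t - t * w.2.2.1)) w.2.2.2,
      sheetPoint_mem hL0 w.1 w.2.1.2 (hs₁ t w.2.2.1) w.2.2.2⟩)
    (by refine Continuous.subtype_mk (continuous_sheetPoint L ?_ ?_ ?_ ?_) _ <;> fun_prop)
    (by
      intro t w w' h
      refine Subtype.ext ?_
      obtain ⟨hr, ⟨hs, hz, h⟩ | ⟨hs, hs', hx, h⟩⟩ := hfib w w' h
      · dsimp only
        rw [← hr, ← hs, ← hz]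
        rcases h with h | h
        · rw [h, mul_zero, min_eq_left (by linarith [t.2.1])]
          exact sheetPoint_zero _ _ _ _
        · rw [h]
      · have ht := t.2
        have e : ∀ s : ℝ, 1 ≤ s →
            min ((1 + (t : ℝ)) * s) (s + 2 * t - t * s) = s + 2 * t - t * s := fun s hs =>
          min_eq_right (by nlinarith [ht.1])
        dsimp only
        rw [e _ hs, e _ hs', hx, ← hr]
        refine sheetPoint_congr _ ?_ ?_ ?_ ?_
        · nlinarith [ht.1, ht.2, w.2.2.1.2.2]
        · nlinarith [ht.1, ht.2, w'.2.2.1.2.2]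
        · linear_combination (1 - (t : ℝ)) * h.1
        · linear_combination (1 - (t : ℝ)) * h.2)
    (by intro w; simp [q])
  -- The path position can now be pulled back to 0: whatever had `s ≥ 1` sits at the cone point,
  -- where `z` plays no role.
  obtain ⟨f₂, hf₂, hf₂'⟩ := exists_homotopic_of_compact_surjection hq hsurj f₁
    (fun t w => ⟨sheetPoint L w.1 ((1 - (t : ℝ)) * w.2.1) (min (2 * (w.2.2.1 : ℝ)) 2) w.2.2.2,
      sheetPoint_mem hL0 w.1 (hz t w.2.1) (hs₂ w.2.2.1) w.2.2.2⟩)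
    (by refine Continuous.subtype_mk (continuous_sheetPoint L ?_ ?_ ?_ ?_) _ <;> fun_prop)
    (by
      intro t w w' h
      refine Subtype.ext ?_
      obtain ⟨hr, ⟨hs, hz, h⟩ | ⟨hs, hs', hx, h⟩⟩ := hfib w w' h
      · dsimp only
        rw [← hr, ← hs, ← hz]
        rcases h with h | h
        · rw [h, mul_zero, min_eq_left zero_le_two]
          exact sheetPoint_zero _ _ _ _
        · rw [h]
      · dsimp only
        rw [min_eq_right (by linarith), min_eq_right (by linarith), hx, ← hr]
        exact sheetPoint_two _ _ _ _)
    (by intro w; rw [hf₁']; norm_num)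
  -- What is left is a segment above position 0 in each copy, times the cube. It slides down to `s =
  -- 0`, where the copies coincide, while `r` shrinks to 0.
  obtain ⟨f₃, hf₃, hf₃'⟩ := exists_homotopic_of_compact_surjection hq hsurj f₂
    (fun t w => ⟨sheetPoint L w.1 0 ((1 - (t : ℝ)) * min (2 * (w.2.2.1 : ℝ)) 2)
        (fun a => unitInterval.symm t * w.2.2.2 a),
      sheetPoint_mem hL0 w.1 ⟨le_rfl, L.cast_nonneg⟩ (hs₃ t w.2.2.1) _⟩)
    (by refine Continuous.subtype_mk (continuous_sheetPoint L ?_ ?_ ?_ ?_) _ <;> fun_prop)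
    (by
      intro t w w' h
      refine Subtype.ext ?_
      obtain ⟨hr, ⟨hs, hz, h⟩ | ⟨hs, hs', hx, h⟩⟩ := hfib w w' h
      · dsimp only
        rw [← hr, ← hs]
        rcases h with h | h
        · rw [h, mul_zero, min_eq_left zero_le_two, mul_zero]
          exact sheetPoint_zero _ _ _ _
        · rw [h]
      · dsimp only
        rw [min_eq_right (by linarith), min_eq_right (by linarith), hx, ← hr])
    (by intro w; rw [hf₂']; simp)
  refine (contractible_iff_id_nullhomotopic _).2 ⟨q (⟨0, hm⟩, ⟨0, le_rfl, L.cast_nonneg⟩,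
    ⟨0, le_rfl, zero_le_two⟩, fun _ => 0), ((hf₁.trans hf₂).trans hf₃).trans ?_⟩
  convert ContinuousMap.Homotopic.refl f₃ using 1
  ext1 p
  obtain ⟨w, rfl⟩ := hsurj p
  rw [hf₃']
  refine Subtype.ext ?_
  simpa [q] using sheetPoint_zero _ _ _ _

/-! ### The single cube and the choice of parameters. -/

theorem contractibleSpace_single_graph (N : ℕ) :
    ContractibleSpace (graphUnion (N := N) (fun (_ : Unit) _ => none) fun _ _ => ()) := by
  have hmem : ∀ t : Fin N → unitInterval,
      (t, ()) ∈ graphUnion (N := N) (fun (_ : Unit) _ => none) fun _ _ => () := fun t =>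
    ⟨(), by simp [cubeFace], rfl⟩
  refine (contractible_iff_id_nullhomotopic _).2 ⟨⟨(fun _ => 0, ()), hmem _⟩,
    ⟨⟨⟨fun p => ⟨(fun i => unitInterval.symm p.1 * p.2.1.1 i, ()), hmem _⟩, ?_⟩, fun p => ?_,
      fun p => ?_⟩⟩⟩
  · refine Continuous.subtype_mk ?_ _
    fun_prop
  · simp
  · simp

/-- The standard cube exhibits a simply connected cube complex with a single facet. -/
theorem exists_single_cube (N : ℕ) :
    ∃ (X : Type) (_ : TopologicalSpace X) (K : CubeComplex X),
      SimplyConnectedSpace X ∧ K.HasDimension N ∧ K.numVertices ≤ 2 ^ N ∧ 1 ≤ K.numFacets N := by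
  have hcont : ∀ _ : Unit, Continuous fun _ : Fin N → unitInterval => () :=
    fun _ => continuous_const
  have hE : ∀ _ _ : Unit, IsCoordCut {t : Fin N → unitInterval |
      t ∈ cubeFace (fun _ => none) ∧ t ∈ cubeFace (fun _ => none) ∧ () = ()} :=
    fun _ _ => ⟨∅, by simp [cubeFace]⟩
  have hdim : faceDim (fun _ : Fin N => none) = N := by simp [faceDim, freeCoords]
  have := contractibleSpace_single_graph N
  refine ⟨_, inferInstance, graphComplex _ _ hcont hE, inferInstance,
    graphComplex_hasDimension _ _ _ _ fun _ => hdim, ?_, ?_⟩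
  · refine (graphComplex_numVertices_le _ _ hcont hE (fun b : Fin N → Bool => (b, ()))
      fun _ b _ => ⟨b, rfl⟩).trans ?_
    simp [Nat.card_eq_fintype_card]
  · simpa using graphComplex_le_numFacets _ _ hcont hE (id : Unit → Unit) (fun _ => hdim)
      fun _ _ _ => rfl

theorem proposition2 (d : ℕ) (hd : 2 ≤ d) :
    ∃ c : ℝ, 0 < c ∧ ∀ n : ℕ, 2 ^ d ≤ n →
      ∃ (X : Type) (_ : TopologicalSpace X) (K : CubeComplex X),
        SimplyConnectedSpace X ∧ K.HasDimension d ∧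
        K.numVertices ≤ n ∧ c * (n : ℝ) ^ 2 ≤ (K.numFacets d : ℝ) := by
  obtain ⟨k, rfl⟩ := Nat.exists_eq_add_of_le' hd
  have hp : (0 : ℝ) < 2 ^ k := by positivity
  refine ⟨1 / (16 * 2 ^ k) ^ 2, by positivity, fun n hn => ?_⟩
  -- From 8 on, `a / 8 ≥ 1` and `a / 2 - 1 ≥ 3`. Below, `c * n ^ 2 ≤ 1` and a single cube is enough.
  rcases lt_or_ge (n / 2 ^ k) 8 with h | h
  · obtain ⟨X, _, K, hX, hK, hV, hF⟩ := exists_single_cube (k + 2)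
    refine ⟨X, _, K, hX, hK, hV.trans hn, ?_⟩
    have hn' : (n : ℝ) ≤ 16 * 2 ^ k := by
      have : n < 8 * 2 ^ k := (Nat.div_lt_iff_lt_mul (by positivity)).1 h
      have : (n : ℝ) < 8 * 2 ^ k := by exact_mod_cast this
      linarith
    calc 1 / (16 * 2 ^ k) ^ 2 * (n : ℝ) ^ 2 ≤ 1 / (16 * 2 ^ k) ^ 2 * (16 * 2 ^ k) ^ 2 := by gcongr
      _ = 1 := by field_simp
      _ ≤ _ := by exact_mod_cast hF
  · set a := n / 2 ^ k with ha
    have hm : 0 < a / 8 := by omega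
    have hL : 3 ≤ a / 2 - 1 := by omega
    -- Taking `m = a / 8` and `L = a / 2 - 1` spends about half of the vertices on the squares and
    -- half on the path: `4 * m + L + 1 ≤ a`. The constant comes from `n ≤ 2 ^ k * (2 * a)`, `a ≤ 16
    -- * m` and `a ≤ 4 * L`.
    have := contractibleSpace_sheets k hm hL
    refine ⟨_, inferInstance, sheetComplex k (a / 8) (a / 2 - 1), inferInstance,
      sheetComplex_hasDimension k hm, ?_, ?_⟩
    · calc _ ≤ 2 ^ k * (4 * (a / 8) + (a / 2 - 1 + 1)) := sheetComplex_numVertices_le _ _ _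
        _ ≤ 2 ^ k * a := Nat.mul_le_mul_left _ (by omega)
        _ ≤ n := Nat.mul_div_le n _
    · have hna : (n : ℝ) ≤ 2 ^ k * (2 * a) := by
        have h₁ : n < 2 ^ k * (a + 1) := Nat.lt_mul_div_succ n (by positivity)
        have h₂ : n ≤ 2 ^ k * (2 * a) := h₁.le.trans (Nat.mul_le_mul_left _ (by omega))
        exact_mod_cast h₂
      have h₁ : (a : ℝ) ≤ 16 * (a / 8 : ℕ) := by exact_mod_cast (by omega : a ≤ 16 * (a / 8))
      have h₂ : (a : ℝ) ≤ 4 * (a / 2 - 1 : ℕ) := by exact_mod_cast (by omega : a ≤ 4 * (a / 2 - 1))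
      calc 1 / (16 * 2 ^ k) ^ 2 * (n : ℝ) ^ 2
          ≤ 1 / (16 * 2 ^ k) ^ 2 * (2 ^ k * (2 * a)) ^ 2 := by gcongr
        _ = (a : ℝ) * a / 64 := by field_simp; ring
        _ ≤ (16 * (a / 8 : ℕ)) * (4 * (a / 2 - 1 : ℕ)) / 64 := by gcongr
        _ = ((a / 8 * (a / 2 - 1) : ℕ) : ℝ) := by push_cast; ring
        _ ≤ _ := by exact_mod_cast le_sheetComplex_numFacets k _ _
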